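/- For a positive integer $m$, let $\omega(m)$ be the number of distinct prime factors of $m$ and $\Omega(m)$ the number of prime factors of $m$ counted with multiplicity; let $\pi(n)$ be the number of primes $p\le n$. Then for every integer $n\ge 0$ (with $0!=1$ and empty sums equal to $0$) $$\omega(n!)=\pi(n)\qquad\text{and}\qquad \Omega(n!)=\sum_{1\le k\le n}\Omega(k).$$ In particular, $$\omega(n!)\sim\frac{n}{\log n}\qquad\text{and}\qquad \Omega(n!)\sim n\log\log n\qquad(n\to\infty).$$ More generally, call a real-valued function $f$ on the positive integers completely additive if $f(mn)=f(m)+f(n)$ for all positive integers $m,n$, and call a real-valued function $g$ on the positive integers strongly additive if $g(mn)=g(m)+g(n)$ for all coprime positive integers $m,n$ and $g(p^a)=g(p)$ for every prime $p$ and every integer $a\ge 1$. If $f$ is completely additive and $g$ is strongly additive, then for every integer $n\ge 0$ $$f(n!)=\sum_{1\le k\le n}f(k)\qquad\text{and}\qquad g(n!)=\sum_{\substack{p\le n\\ p\ \text{prime}}}g(p).$$ -/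

import Mathlib

open Filter Asymptotics ArithmeticFunction
open scoped Nat Topology

/-- `f` (viewed as a function on the positive integers; its value at `0` is irrelevant) is
completely additive: `f (m * n) = f m + f n` for all positive integers `m`, `n`. -/
def IsCompletelyAdditive (f : ℕ → ℝ) : Prop :=
  ∀ m n : ℕ, 0 < m → 0 < n → f (m * n) = f m + f n

/-- `f` (viewed as a function on the positive integers; its value at `0` is irrelevant) is
additive: `f (m * n) = f m + f n` for all coprime positive integers `m`, `n`. -/
def IsAdditiveOnCoprime (f : ℕ → ℝ) : Prop :=
  ∀ m n : ℕ, 0 < m → 0 < n → Nat.Coprime m n → f (m * n) = f m + f n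

/-- `f` is strongly additive: it is additive, and `f (p ^ a) = f p` for every prime `p` and every
positive integer `a`. -/
def IsStronglyAdditive (f : ℕ → ℝ) : Prop :=
  IsAdditiveOnCoprime f ∧ ∀ p a : ℕ, p.Prime → 0 < a → f (p ^ a) = f p

/-! The exact formulas are elementary: a completely additive function turns the product `n !` into a
sum, and a strongly additive one sees each prime divisor once, the prime divisors of `n !` being the
primes up to `n`.

So the asymptotic for `ω(n!) = π(n)` is the prime number theorem. It comes from a Wiener–Ikehara
argument applied to `g u = ψ(e^u) e^{-u}`. The Laplace transform of `g - 1` extends continuously to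
the imaginary axis, because `-ζ'/ζ` has only a simple pole at `1` on the closed half-plane `Re s ≥
1`. Riemann–Lebesgue then controls the Fejér means of `g` (`tendsto_fejer_mean_of_laplace`), and
monotonicity of `e^u g u` passes from means to values (`tendsto_one_of_laplace_sub_one`).

For `Ω`, Legendre's formula gives `v_p(n!) ≈ n/p` with total error at most `n`
(`abs_cardFactors_factorial_sub_le`). Partial summation of the prime number theorem gives `∑_{p ≤ n}
1/p ~ log log n` (`sumPrimeInv_isEquivalent`), which dominates that error after division by `n`. -/

/-! ### The Fejér kernel and its Fourier representation. -/

/-- The Fejér kernel. -/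
noncomputable def fejerKernel (v : ℝ) : ℝ := Real.sinc (v / 2) ^ 2

lemma fejerKernel_nonneg (v : ℝ) : 0 ≤ fejerKernel v := sq_nonneg _

lemma continuous_fejerKernel : Continuous fejerKernel := by
  unfold fejerKernel
  exact (Real.continuous_sinc.comp (continuous_id.div_const 2)).pow 2

/-- Half-angle identity, used both for the quadratic decay of the kernel and to recognise it as a
Fourier integral. -/
lemma sq_mul_fejerKernel (v : ℝ) : v ^ 2 * fejerKernel v = 2 * (1 - Real.cos v) := by
  rcases eq_or_ne v 0 with rfl | hv
  · simp
  · have h : Real.cos v = 1 - 2 * Real.sin (v / 2) ^ 2 := by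
      have := Real.cos_two_mul (v / 2)
      have h2 := Real.sin_sq_add_cos_sq (v / 2)
      rw [show 2 * (v / 2) = v by ring] at this
      linarith
    rw [fejerKernel, Real.sinc_of_ne_zero (by positivity), h]
    field_simp
    ring

lemma fejerKernel_le (v : ℝ) : fejerKernel v ≤ 5 * (1 + v ^ 2)⁻¹ := by
  rw [← div_eq_mul_inv, le_div_iff₀ (by positivity)]
  have h1 : fejerKernel v ≤ 1 := by
    rw [fejerKernel, sq_le_one_iff_abs_le_one]
    exact Real.abs_sinc_le_one _
  have h2 := sq_mul_fejerKernel v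
  have h3 := Real.neg_one_le_cos v
  nlinarith

lemma integrable_fejerKernel : MeasureTheory.Integrable fejerKernel := by
  refine (integrable_inv_one_add_sq.const_mul 5).mono'
    continuous_fejerKernel.aestronglyMeasurable (Eventually.of_forall fun v => ?_)
  rw [Real.norm_of_nonneg (fejerKernel_nonneg v)]
  exact fejerKernel_le v

lemma integral_fejerKernel_pos : 0 < ∫ v, fejerKernel v := by
  rw [MeasureTheory.integral_pos_iff_support_of_nonneg fejerKernel_nonneg integrable_fejerKernel]
  refine (continuous_fejerKernel.isOpen_support).measure_pos _ ⟨0, ?_⟩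
  simp [fejerKernel]

lemma integral_one_sub_mul_exp {c : ℂ} (hc : c ≠ 0) :
    ∫ t in (0 : ℝ)..1, ((1 - t : ℝ) : ℂ) * Complex.exp (t * c) =
      Complex.exp c / c ^ 2 - 1 / c - 1 / c ^ 2 := by
  have hderiv (t : ℝ) : HasDerivAt
      (fun t : ℝ => ((1 - t : ℝ) : ℂ) * Complex.exp (t * c) / c + Complex.exp (t * c) / c ^ 2)
      (((1 - t : ℝ) : ℂ) * Complex.exp (t * c)) t := by
    have h1 : HasDerivAt (fun t : ℝ => (t : ℂ)) 1 t := Complex.ofRealCLM.hasDerivAt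
    have h2 : HasDerivAt (fun t : ℝ => Complex.exp (t * c)) (Complex.exp (t * c) * (1 * c)) t :=
      (h1.mul_const c).cexp
    have h3 : HasDerivAt (fun t : ℝ => ((1 - t : ℝ) : ℂ)) (-1) t := by
      simpa using h1.const_sub 1
    refine (((h3.mul h2).div_const c).add (h2.div_const (c ^ 2))).congr_deriv ?_
    field_simp
    ring
  rw [intervalIntegral.integral_eq_sub_of_hasDerivAt (fun t _ => hderiv t)
    (Continuous.intervalIntegrable (by fun_prop) _ _)]
  simp
  ring

/-- The Fejér kernel is the Fourier transform of the triangle function. -/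
lemma integral_one_sub_abs_mul_exp (v : ℝ) :
    ∫ t in (-1 : ℝ)..1, ((1 - |t| : ℝ) : ℂ) * Complex.exp (t * (v * Complex.I)) =
      fejerKernel v := by
  have hcont : Continuous fun t : ℝ =>
      ((1 - |t| : ℝ) : ℂ) * Complex.exp (t * (v * Complex.I)) := by fun_prop
  have hpos : ∫ t in (0 : ℝ)..1, ((1 - |t| : ℝ) : ℂ) * Complex.exp (t * (v * Complex.I)) =
      ∫ t in (0 : ℝ)..1, ((1 - t : ℝ) : ℂ) * Complex.exp (t * (v * Complex.I)) := by
    refine intervalIntegral.integral_congr fun t ht => ?_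
    rw [Set.uIcc_of_le zero_le_one] at ht
    simp only [abs_of_nonneg ht.1]
  have hneg : ∫ t in (-1 : ℝ)..0, ((1 - |t| : ℝ) : ℂ) * Complex.exp (t * (v * Complex.I)) =
      ∫ t in (0 : ℝ)..1, ((1 - t : ℝ) : ℂ) * Complex.exp (t * (-(v * Complex.I))) := by
    have h := intervalIntegral.integral_comp_neg (a := 0) (b := 1)
      (fun t : ℝ => ((1 - |t| : ℝ) : ℂ) * Complex.exp (t * (v * Complex.I)))
    rw [neg_zero] at h
    rw [← h]
    refine intervalIntegral.integral_congr fun t ht => ?_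
    rw [Set.uIcc_of_le zero_le_one] at ht
    simp only [abs_neg, abs_of_nonneg ht.1, Complex.ofReal_neg, neg_mul, mul_neg]
  rw [← intervalIntegral.integral_add_adjacent_intervals (hcont.intervalIntegrable (-1) 0)
    (hcont.intervalIntegrable 0 1), hpos, hneg]
  rcases eq_or_ne v 0 with rfl | hv
  · have h : ∫ t in (0 : ℝ)..1, ((1 - t : ℝ) : ℂ) = ((1 / 2 : ℝ) : ℂ) := by
      rw [intervalIntegral.integral_ofReal, intervalIntegral.integral_sub (by simp) (by simp)]
      norm_num
    simp only [Complex.ofReal_zero, zero_mul, neg_zero, mul_zero, Complex.exp_zero, mul_one, h]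
    norm_num [fejerKernel]
  · have hc : (v : ℂ) * Complex.I ≠ 0 := by simp [hv]
    rw [integral_one_sub_mul_exp hc, integral_one_sub_mul_exp (neg_ne_zero.mpr hc)]
    have h1 := congrArg (fun x : ℝ => (x : ℂ)) (sq_mul_fejerKernel v)
    have h2 := Complex.two_cos (v : ℂ)
    push_cast at h1
    have hv' : (v : ℂ) ≠ 0 := by exact_mod_cast hv
    have h3 : ((v : ℂ) * Complex.I) ^ 2 = -(v : ℂ) ^ 2 := by
      rw [mul_pow, Complex.I_sq]; ring
    rw [neg_sq, h3, ← mul_right_inj' (pow_ne_zero 2 hv'), h1, mul_sub, mul_one, h2, neg_mul]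
    field_simp
    ring

/-! ### Fejér means and the Tauberian theorem. -/

open MeasureTheory Set in
/-- Fubini's theorem for the Laplace transform integrated against the triangle function. -/
lemma integral_triangle_mul_laplace {h : ℝ → ℝ} (hmeas : Measurable h) {C : ℝ}
    (hC : ∀ u, |h u| ≤ C) {δ : ℝ} (hδ : 0 < δ) (y : ℝ) :
    ∫ t in (-1 : ℝ)..1, ((1 - |t| : ℝ) : ℂ) * Complex.exp (t * (y * Complex.I)) *
        ∫ u in Ioi (0 : ℝ), (h u : ℂ) * Complex.exp (-(δ + t * Complex.I) * u) =
      ∫ u in Ioi (0 : ℝ), ((h u * Real.exp (-δ * u) * fejerKernel (y - u) : ℝ) : ℂ) := by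
  have hC0 : 0 ≤ C := (abs_nonneg _).trans (hC 0)
  have hnorm (t u : ℝ) : ‖((1 - |t| : ℝ) : ℂ) * Complex.exp (t * (y * Complex.I)) *
      ((h u : ℂ) * Complex.exp (-(δ + t * Complex.I) * u))‖ =
      |(1 - |t|)| * (|h u| * Real.exp (-δ * u)) := by
    simp only [norm_mul, Complex.norm_real, Complex.norm_exp, Real.norm_eq_abs]
    simp
  have hint : Integrable (Function.uncurry fun t u : ℝ =>
      ((1 - |t| : ℝ) : ℂ) * Complex.exp (t * (y * Complex.I)) *
        ((h u : ℂ) * Complex.exp (-(δ + t * Complex.I) * u)))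
      ((volume.restrict (Ioc (-1) 1)).prod (volume.restrict (Ioi 0))) := by
    have hb : Integrable (fun z : ℝ × ℝ => |(1 - |z.1|)| * (C * Real.exp (-δ * z.2)))
        ((volume.restrict (Ioc (-1) 1)).prod (volume.restrict (Ioi 0))) := by
      refine Integrable.mul_prod (f := fun t : ℝ => |(1 - |t|)|)
        (g := fun u : ℝ => C * Real.exp (-δ * u)) ?_ ?_
      · exact (Continuous.integrableOn_Icc (by fun_prop)).mono_set Ioc_subset_Icc_self
      · exact (integrableOn_exp_mul_Ioi (neg_neg_of_pos hδ) 0).const_mul C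
    refine hb.mono' ?_ (Eventually.of_forall fun z => ?_)
    · refine Measurable.aestronglyMeasurable ?_
      simp only [Function.uncurry_def]
      fun_prop
    · simp only [Function.uncurry_def]
      rw [hnorm]
      gcongr
      exact hC _
  simp_rw [← integral_const_mul]
  rw [intervalIntegral.integral_of_le (by norm_num), integral_integral_swap hint]
  refine setIntegral_congr_fun measurableSet_Ioi fun u _ => ?_
  push_cast
  rw [← integral_one_sub_abs_mul_exp (y - u), intervalIntegral.integral_of_le (by norm_num),
    ← integral_const_mul]
  refine integral_congr_ae (Eventually.of_forall fun t => ?_)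
  have : Complex.exp (t * (y * Complex.I)) * Complex.exp (-(δ + t * Complex.I) * u) =
      Complex.exp (-δ * u) * Complex.exp (t * (((y - u : ℝ) : ℂ) * Complex.I)) := by
    rw [← Complex.exp_add, ← Complex.exp_add]
    push_cast
    ring_nf
  push_cast at this ⊢
  linear_combination (1 - (|t| : ℝ) : ℂ) * (h u) * this

-- The Fubini identity passes to the limit `δ → 0⁺` by dominated convergence: on the left `G` is
-- bounded on a compact rectangle, on the right `C` times the kernel dominates.
open MeasureTheory Set in
lemma integral_triangle_mul_boundary {h : ℝ → ℝ} (hmeas : Measurable h) {C : ℝ}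
    (hC : ∀ u, |h u| ≤ C) {G : ℂ → ℂ} (hG : ContinuousOn G {s | 0 ≤ s.re})
    (hlap : ∀ s : ℂ, 0 < s.re → ∫ u in Ioi (0 : ℝ), (h u : ℂ) * Complex.exp (-s * u) = G s)
    (y : ℝ) :
    ∫ t in (-1 : ℝ)..1, ((1 - |t| : ℝ) : ℂ) * Complex.exp (t * (y * Complex.I)) *
        G (t * Complex.I) =
      ((∫ u in Ioi (0 : ℝ), h u * fejerKernel (y - u) : ℝ) : ℂ) := by
  have hC0 : 0 ≤ C := (abs_nonneg _).trans (hC 0)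
  have hGt (δ : ℝ) (hδ : 0 ≤ δ) : Continuous fun t : ℝ => G (δ + t * Complex.I) :=
    hG.comp_continuous (by fun_prop) fun t => by simpa using hδ
  obtain ⟨B, hB⟩ : ∃ B, ∀ z ∈ Icc (0 : ℝ) 1 ×ˢ Icc (-1 : ℝ) 1,
      ‖G (z.1 + z.2 * Complex.I)‖ ≤ B := by
    refine (isCompact_Icc.prod isCompact_Icc).exists_bound_of_continuousOn ?_
    refine hG.comp (by fun_prop) fun z hz => ?_
    simpa using hz.1.1
  have hlim1 : Tendsto (fun δ : ℝ => ∫ t in (-1 : ℝ)..1,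
      ((1 - |t| : ℝ) : ℂ) * Complex.exp (t * (y * Complex.I)) * G (δ + t * Complex.I))
      (𝓝[>] 0) (𝓝 (∫ t in (-1 : ℝ)..1,
        ((1 - |t| : ℝ) : ℂ) * Complex.exp (t * (y * Complex.I)) * G (t * Complex.I))) := by
    refine intervalIntegral.tendsto_integral_filter_of_dominated_convergence (fun _ => B) ?_ ?_
      (by simp) ?_
    · filter_upwards [self_mem_nhdsWithin] with δ hδ
      have := hGt δ (le_of_lt hδ)
      exact (Continuous.mul (by fun_prop) this).aestronglyMeasurable
    · filter_upwards [Ioo_mem_nhdsGT (zero_lt_one' ℝ)] with δ hδ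
      refine Eventually.of_forall fun t ht => ?_
      rw [uIoc_of_le (by norm_num)] at ht
      have h1 := hB (δ, t) ⟨⟨hδ.1.le, hδ.2.le⟩, ht.1.le, ht.2⟩
      have h2 : ‖((1 - |t| : ℝ) : ℂ)‖ ≤ 1 := by
        rw [Complex.norm_real, Real.norm_eq_abs, abs_le]
        have := abs_nonneg t
        have : |t| ≤ 1 := abs_le.mpr ⟨ht.1.le, ht.2⟩
        constructor <;> linarith
      have h3 : ‖Complex.exp (t * (y * Complex.I))‖ = 1 := by
        rw [Complex.norm_exp]
        simp
      rw [norm_mul, norm_mul, h3, mul_one]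
      exact (mul_le_of_le_one_left (norm_nonneg _) h2).trans h1
    · refine Eventually.of_forall fun t _ => Tendsto.const_mul _ ?_
      have h1 : ContinuousWithinAt G {s | 0 ≤ s.re} (t * Complex.I) := hG _ (by simp)
      refine h1.tendsto.comp (tendsto_nhdsWithin_iff.mpr ⟨?_, ?_⟩)
      · have : Continuous fun δ : ℝ => (δ : ℂ) + t * Complex.I := by fun_prop
        simpa using (this.tendsto 0).mono_left nhdsWithin_le_nhds
      · filter_upwards [self_mem_nhdsWithin] with δ hδ
        simpa using le_of_lt hδ
  have hlim2 : Tendsto (fun δ : ℝ => ∫ u in Ioi (0 : ℝ),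
      ((h u * Real.exp (-δ * u) * fejerKernel (y - u) : ℝ) : ℂ))
      (𝓝[>] 0) (𝓝 (∫ u in Ioi (0 : ℝ), ((h u * fejerKernel (y - u) : ℝ) : ℂ))) := by
    have hK := (integrable_fejerKernel.comp_sub_left y)
    refine tendsto_integral_filter_of_dominated_convergence (fun u => C * fejerKernel (y - u))
      ?_ ?_ (hK.const_mul C).integrableOn ?_
    · refine Eventually.of_forall fun δ => Measurable.aestronglyMeasurable ?_
      have := continuous_fejerKernel.measurable
      fun_prop
    · filter_upwards [self_mem_nhdsWithin] with δ hδ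
      filter_upwards [ae_restrict_mem measurableSet_Ioi] with u hu
      rw [Complex.norm_real, norm_mul, norm_mul, Real.norm_of_nonneg (fejerKernel_nonneg _),
        Real.norm_of_nonneg (Real.exp_nonneg _)]
      refine mul_le_mul_of_nonneg_right ?_ (fejerKernel_nonneg _)
      have h1 : Real.exp (-δ * u) ≤ 1 := by
        rw [Real.exp_le_one_iff, neg_mul, neg_nonpos]
        exact mul_nonneg (le_of_lt hδ) (le_of_lt hu)
      exact (mul_le_of_le_one_right (abs_nonneg _) h1).trans (hC u)
    · refine Eventually.of_forall fun u => ?_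
      have : Continuous fun δ : ℝ =>
          ((h u * Real.exp (-δ * u) * fejerKernel (y - u) : ℝ) : ℂ) := by fun_prop
      simpa using (this.tendsto 0).mono_left nhdsWithin_le_nhds
  rw [← integral_complex_ofReal]
  refine tendsto_nhds_unique (hlim1.congr' ?_) hlim2
  filter_upwards [self_mem_nhdsWithin] with δ hδ
  rw [← integral_triangle_mul_laplace hmeas hC hδ]
  refine intervalIntegral.integral_congr fun t _ => ?_
  rw [hlap _ (by simpa using hδ)]

open MeasureTheory Set in
/-- A bounded function whose Laplace transform extends continuously to the imaginary axis has
vanishing Fejér means at infinity. -/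
theorem tendsto_fejer_mean_of_laplace {h : ℝ → ℝ} (hmeas : Measurable h) {C : ℝ}
    (hC : ∀ u, |h u| ≤ C) {G : ℂ → ℂ} (hG : ContinuousOn G {s | 0 ≤ s.re})
    (hlap : ∀ s : ℂ, 0 < s.re → ∫ u in Ioi (0 : ℝ), (h u : ℂ) * Complex.exp (-s * u) = G s) :
    Tendsto (fun y : ℝ => ∫ u in Ioi (0 : ℝ), h u * fejerKernel (y - u)) atTop (𝓝 0) := by
  -- Riemann–Lebesgue: the boundary identity exhibits the mean at `y` as a Fourier transform at
  -- frequency `-y / (2π)` of a function supported on `(-1, 1]`.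
  have hRL := Real.tendsto_integral_exp_smul_cocompact
    ((Ioc (-1 : ℝ) 1).indicator fun t : ℝ => ((1 - |t| : ℝ) : ℂ) * G (t * Complex.I))
  have hw : Tendsto (fun y : ℝ => (-(2 * Real.pi)⁻¹) * y) atTop (cocompact ℝ) :=
    (tendsto_id.const_mul_atTop_of_neg (by simp [Real.pi_pos])).mono_right atBot_le_cocompact
  have h0 := hRL.comp hw
  rw [← Complex.ofReal_zero] at h0
  refine (Complex.continuous_re.tendsto _).comp h0 |>.congr fun y => ?_
  simp only [Function.comp_apply]
  rw [← Complex.ofReal_re (∫ u in Ioi (0 : ℝ), h u * fejerKernel (y - u)),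
    ← integral_triangle_mul_boundary hmeas hC hG hlap y,
    intervalIntegral.integral_of_le (by norm_num), ← integral_indicator measurableSet_Ioc]
  congr 2
  funext t
  by_cases ht : t ∈ Ioc (-1 : ℝ) 1
  · rw [indicator_of_mem ht, indicator_of_mem ht, Circle.smul_def, Real.fourierChar_apply,
      smul_eq_mul]
    have : 2 * Real.pi * -(t * (-(2 * Real.pi)⁻¹ * y)) = t * y := by
      field_simp
    rw [this]
    push_cast
    ring_nf
  · rw [indicator_of_notMem ht, indicator_of_notMem ht, smul_zero]

open MeasureTheory Set in
lemma tendsto_setIntegral_fejerKernel_sub :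
    Tendsto (fun y : ℝ => ∫ u in Ioi (0 : ℝ), fejerKernel (y - u)) atTop
      (𝓝 (∫ v, fejerKernel v)) := by
  have h := (aecover_Iio (μ := (volume : Measure ℝ))
    tendsto_id).integral_tendsto_of_countably_generated integrable_fejerKernel
  refine h.congr fun y => ?_
  rw [← integral_indicator measurableSet_Iio, ← integral_indicator measurableSet_Ioi,
    ← integral_sub_left_eq_self _ volume y]
  congr 1
  funext u
  simp [indicator_apply]

-- The hypothesis is invariant under dilation: stretching by `l` replaces `G s` by `l * G (l * s)`.
-- With `l` large, a fixed window for the kernel becomes a short window of length `O(1/l)` for `g`.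
open MeasureTheory Set in
lemma tendsto_fejer_mean_of_laplace_sub_one {g : ℝ → ℝ} (hmeas : Measurable g) {C : ℝ}
    (hg0 : ∀ u, 0 ≤ g u) (hC : ∀ u, g u ≤ C) {G : ℂ → ℂ} (hG : ContinuousOn G {s | 0 ≤ s.re})
    (hlap : ∀ s : ℂ, 0 < s.re →
      ∫ u in Ioi (0 : ℝ), ((g u - 1 : ℝ) : ℂ) * Complex.exp (-s * u) = G s)
    {l : ℝ} (hl : 0 < l) :
    Tendsto (fun y : ℝ => ∫ u in Ioi (0 : ℝ), g (l⁻¹ * u) * fejerKernel (y - u)) atTop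
      (𝓝 (∫ v, fejerKernel v)) := by
  have hK (y : ℝ) := (integrable_fejerKernel.comp_sub_left y).integrableOn (s := Ioi (0 : ℝ))
  have h1 : Tendsto (fun y : ℝ => ∫ u in Ioi (0 : ℝ), (g (l⁻¹ * u) - 1) * fejerKernel (y - u))
      atTop (𝓝 0) := by
    refine tendsto_fejer_mean_of_laplace (C := C + 1) (G := fun s => l * G (l * s)) ?_ ?_ ?_ ?_
    · fun_prop
    · intro u
      rw [abs_le]
      constructor <;> linarith [hg0 (l⁻¹ * u), hC (l⁻¹ * u)]
    · refine continuousOn_const.mul (hG.comp (by fun_prop) fun s hs => ?_)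
      simpa using mul_nonneg hl.le hs
    · intro s hs
      have := integral_comp_mul_left_Ioi
        (fun u : ℝ => ((g u - 1 : ℝ) : ℂ) * Complex.exp (-(l * s) * u)) 0 (inv_pos.mpr hl)
      rw [mul_zero, hlap (l * s) (by simpa using mul_pos hl hs), inv_inv] at this
      rw [← Complex.real_smul, ← this]
      refine setIntegral_congr_fun measurableSet_Ioi fun u _ => ?_
      have hl' : (l : ℂ) ≠ 0 := by exact_mod_cast hl.ne'
      congr 2
      push_cast
      field_simp
  have h2 := h1.add tendsto_setIntegral_fejerKernel_sub
  rw [zero_add] at h2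
  refine h2.congr fun y => ?_
  rw [← integral_add ?_ (hK y)]
  · refine integral_congr_ae (Eventually.of_forall fun u => ?_)
    ring
  · refine (hK y).bdd_mul (c := C + 1) ?_ (Eventually.of_forall fun u => ?_)
    · exact Measurable.aestronglyMeasurable (by fun_prop)
    · rw [Real.norm_eq_abs, abs_le]
      constructor <;> linarith [hg0 (l⁻¹ * u), hC (l⁻¹ * u)]

open MeasureTheory Set in
lemma integrable_mul_fejerKernel_sub {g : ℝ → ℝ} (hmeas : Measurable g) {C : ℝ}
    (hg0 : ∀ u, 0 ≤ g u) (hC : ∀ u, g u ≤ C) (y : ℝ) :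
    Integrable fun u => g u * fejerKernel (y - u) := by
  refine (integrable_fejerKernel.comp_sub_left y).bdd_mul (c := C) hmeas.aestronglyMeasurable
    (Eventually.of_forall fun u => ?_)
  rw [Real.norm_of_nonneg (hg0 u)]
  exact hC u

open MeasureTheory Set in
lemma setIntegral_Icc_fejerKernel_sub (w : ℝ) {N : ℝ} (hN : 0 ≤ N) :
    ∫ u in Icc (w - N) (w + N), fejerKernel (w - u) = ∫ v in (-N)..N, fejerKernel v := by
  rw [integral_Icc_eq_integral_Ioc, ← intervalIntegral.integral_of_le (by linarith),
    intervalIntegral.integral_comp_sub_left]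
  ring_nf

open MeasureTheory Set in
/-- A lower bound for a Fejér mean in terms of a lower bound on a window. -/
lemma mul_integral_le_fejer_mean {g : ℝ → ℝ} (hmeas : Measurable g) {C : ℝ}
    (hg0 : ∀ u, 0 ≤ g u) (hC : ∀ u, g u ≤ C) {a y N : ℝ} (hN : 0 ≤ N) (hy : N < y)
    (ha : ∀ u ∈ Icc (y - N) (y + N), a ≤ g u) :
    a * ∫ v in (-N)..N, fejerKernel v ≤ ∫ u in Ioi (0 : ℝ), g u * fejerKernel (y - u) := by
  have hint := integrable_mul_fejerKernel_sub hmeas hg0 hC y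
  rw [← setIntegral_Icc_fejerKernel_sub y hN, ← integral_const_mul]
  calc _ ≤ ∫ u in Icc (y - N) (y + N), g u * fejerKernel (y - u) := by
        refine setIntegral_mono_on ?_ hint.integrableOn measurableSet_Icc fun u hu =>
          mul_le_mul_of_nonneg_right (ha u hu) (fejerKernel_nonneg _)
        exact ((integrable_fejerKernel.comp_sub_left y).const_mul a).integrableOn
    _ ≤ _ := by
        refine setIntegral_mono_set hint.integrableOn
          (Eventually.of_forall fun u => mul_nonneg (hg0 u) (fejerKernel_nonneg _))
          (Eventually.of_forall fun u hu => ?_)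
        exact lt_of_lt_of_le (by linarith) hu.1

open MeasureTheory Set in
/-- An upper bound for a Fejér mean in terms of an upper bound on a window. -/
lemma fejer_mean_le_mul_integral_add {g : ℝ → ℝ} (hmeas : Measurable g) {C : ℝ}
    (hg0 : ∀ u, 0 ≤ g u) (hC : ∀ u, g u ≤ C) {a y N : ℝ} (hN : 0 ≤ N) (ha0 : 0 ≤ a)
    (ha : ∀ u ∈ Icc (y - N) (y + N), g u ≤ a) :
    ∫ u in Ioi (0 : ℝ), g u * fejerKernel (y - u) ≤
      a * (∫ v, fejerKernel v) + C * ((∫ v, fejerKernel v) - ∫ v in (-N)..N, fejerKernel v) := by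
  have hint := integrable_mul_fejerKernel_sub hmeas hg0 hC y
  have hC0 : 0 ≤ C := (hg0 0).trans (hC 0)
  have hK := integrable_fejerKernel.comp_sub_left y
  have hKI : Integrable fun u =>
      (Icc (y - N) (y + N)).indicator (fun u => fejerKernel (y - u)) u :=
    hK.indicator measurableSet_Icc
  have hD : Integrable fun u => C * (fejerKernel (y - u) -
      (Icc (y - N) (y + N)).indicator (fun u => fejerKernel (y - u)) u) :=
    (hK.sub hKI).const_mul C
  rw [← setIntegral_Icc_fejerKernel_sub y hN, ← integral_indicator measurableSet_Icc,
    ← integral_sub_left_eq_self fejerKernel volume y, ← integral_sub hK hKI,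
    ← integral_const_mul, ← integral_const_mul,
    ← integral_add (hK.const_mul a) hD]
  refine (setIntegral_le_integral hint
    (Eventually.of_forall fun u => mul_nonneg (hg0 u) (fejerKernel_nonneg _))).trans ?_
  refine integral_mono hint ((hK.const_mul a).add hD) fun u => ?_
  have hKu := fejerKernel_nonneg (y - u)
  by_cases hu : u ∈ Icc (y - N) (y + N)
  · simp only [indicator_of_mem hu, sub_self, mul_zero, add_zero]
    exact mul_le_mul_of_nonneg_right (ha u hu) hKu
  · simp only [indicator_of_notMem hu, sub_zero]
    have := mul_le_mul_of_nonneg_right (hC u) hKu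
    have := mul_nonneg ha0 hKu
    linarith

open MeasureTheory Set in
/-- **Wiener–Ikehara Tauberian theorem** for bounded functions: if `g` is bounded, nonnegative,
`exp u * g u` is nondecreasing, and the Laplace transform of `g - 1` extends continuously to the
imaginary axis, then `g` tends to `1`. -/
theorem tendsto_one_of_laplace_sub_one {g : ℝ → ℝ} (hmeas : Measurable g) {C : ℝ}
    (hg0 : ∀ u, 0 ≤ g u) (hC : ∀ u, g u ≤ C)
    (hmono : ∀ u v, u ≤ v → g u * Real.exp (u - v) ≤ g v)
    {G : ℂ → ℂ} (hG : ContinuousOn G {s | 0 ≤ s.re})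
    (hlap : ∀ s : ℂ, 0 < s.re →
      ∫ u in Ioi (0 : ℝ), ((g u - 1 : ℝ) : ℂ) * Complex.exp (-s * u) = G s) :
    Tendsto g atTop (𝓝 1) := by
  set M := ∫ v, fejerKernel v with hM
  have hM0 : 0 < M := integral_fejerKernel_pos
  have hMN : Tendsto (fun N : ℝ => ∫ v in (-N)..N, fejerKernel v) atTop (𝓝 M) :=
    intervalIntegral_tendsto_integral integrable_fejerKernel tendsto_neg_atTop_atBot tendsto_id
  have hexp (N : ℝ) : Tendsto (fun l : ℝ => Real.exp (2 * N * l⁻¹)) atTop (𝓝 1) := by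
    have := (tendsto_inv_atTop_zero (𝕜 := ℝ)).const_mul (2 * N)
    rw [mul_zero] at this
    simpa [Function.comp_def] using (Real.continuous_exp.tendsto 0).comp this
  have hJ {l : ℝ} (hl : 0 < l) := tendsto_fejer_mean_of_laplace_sub_one hmeas hg0 hC hG hlap hl
  have hgl (l : ℝ) : Measurable fun u => g (l⁻¹ * u) := by fun_prop
  have hcomp {l : ℝ} (hl : 0 < l) {p : ℝ → Prop} (h : ∀ᶠ w in atTop, p (g (l⁻¹ * w))) :
      ∀ᶠ x in atTop, p (g x) := by
    filter_upwards [(tendsto_id.const_mul_atTop hl).eventually h] with x hx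
    simpa [hl.ne'] using hx
  refine tendsto_order.mpr ⟨fun a ha => ?_, fun b hb => ?_⟩
  -- First `N` makes the kernel mass outside the window negligible; then `l` brings the growth
  -- factor `exp (2N/l)` over the window close to `1`.
  · obtain ⟨N, hN, hN0⟩ : ∃ N : ℝ,
        a * M < M - C * (M - ∫ v in (-N)..N, fejerKernel v) ∧ 0 ≤ N := by
      have h := ((hMN.const_sub M).const_mul C).const_sub M
      rw [sub_self, mul_zero, sub_zero] at h
      have hlt : a * M < M := by nlinarith
      exact ((h.eventually_const_lt hlt).and (eventually_ge_atTop 0)).exists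
    obtain ⟨l, hl, hl0⟩ : ∃ l : ℝ, a * M * Real.exp (2 * N * l⁻¹) <
        M - C * (M - ∫ v in (-N)..N, fejerKernel v) ∧ 0 < l := by
      have h := (hexp N).const_mul (a * M)
      rw [mul_one] at h
      exact ((h.eventually_lt_const hN).and (eventually_gt_atTop 0)).exists
    refine hcomp hl0 (p := fun z => a < z) ?_
    -- The window `[w - 2N, w]` ends at `w`, so monotonicity bounds `g` on it from above by its
    -- value at `w`.
    have hJ' := ((hJ hl0).comp (tendsto_atTop_add_const_right _ (-N) tendsto_id)).sub_const
      (C * (M - ∫ v in (-N)..N, fejerKernel v))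
    filter_upwards [hJ'.eventually_const_lt hl] with w hw
    have hub := fejer_mean_le_mul_integral_add (hgl l) (fun u => hg0 _) (fun u => hC _)
      (a := g (l⁻¹ * w) * Real.exp (2 * N * l⁻¹)) (y := w + -N) hN0
      (mul_nonneg (hg0 _) (Real.exp_nonneg _)) (fun u hu => ?_)
    · simp only [Function.comp_apply, id_eq] at hw
      rw [← hM] at hub
      have h1 : a * (M * Real.exp (2 * N * l⁻¹)) <
          g (l⁻¹ * w) * (M * Real.exp (2 * N * l⁻¹)) := by linarith
      exact lt_of_mul_lt_mul_right h1 (by positivity)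
    · have hinv : 0 < l⁻¹ := inv_pos.mpr hl0
      have h1 := hmono (l⁻¹ * u) (l⁻¹ * w)
        (mul_le_mul_of_nonneg_left (by linarith [hu.2]) hinv.le)
      have h2 : l⁻¹ * w - l⁻¹ * u ≤ 2 * N * l⁻¹ := by nlinarith [hu.1]
      calc g (l⁻¹ * u) = g (l⁻¹ * u) * Real.exp (l⁻¹ * u - l⁻¹ * w) *
            Real.exp (l⁻¹ * w - l⁻¹ * u) := by
            rw [mul_assoc, ← Real.exp_add]
            simp
        _ ≤ _ := by
            gcongr
            exact hg0 _
  · obtain ⟨N, hN, hN0⟩ : ∃ N : ℝ, M < b * (∫ v in (-N)..N, fejerKernel v) ∧ 0 ≤ N := by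
      have hlt : M < b * M := by nlinarith
      exact (((hMN.const_mul b).eventually_const_lt hlt).and (eventually_ge_atTop 0)).exists
    have hMN0 : 0 < ∫ v in (-N)..N, fejerKernel v := by
      by_contra! h
      nlinarith
    obtain ⟨l, hl, hl0⟩ : ∃ l : ℝ, M * Real.exp (2 * N * l⁻¹) <
        b * (∫ v in (-N)..N, fejerKernel v) ∧ 0 < l := by
      have h := (hexp N).const_mul M
      rw [mul_one] at h
      exact ((h.eventually_lt_const hN).and (eventually_gt_atTop 0)).exists
    refine hcomp hl0 (p := fun z => z < b) ?_
    -- Now the window `[w, w + 2N]` starts at `w`, so `g` is bounded below on it.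
    have hJ' := ((hJ hl0).comp (tendsto_atTop_add_const_right _ N tendsto_id)).mul_const
      (Real.exp (2 * N * l⁻¹))
    filter_upwards [hJ'.eventually_lt_const hl, eventually_gt_atTop 0] with w hw hw0
    have hlb := mul_integral_le_fejer_mean (hgl l) (fun u => hg0 _) (fun u => hC _)
      (a := g (l⁻¹ * w) * Real.exp (-(2 * N * l⁻¹))) (y := w + N) hN0 (by linarith)
      (fun u hu => ?_)
    · simp only [Function.comp_apply, id_eq] at hw
      have h1 := (mul_le_mul_of_nonneg_right hlb
        (Real.exp_nonneg (2 * N * l⁻¹))).trans_lt hw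
      have h2 : Real.exp (-(2 * N * l⁻¹)) * Real.exp (2 * N * l⁻¹) = 1 := by
        rw [← Real.exp_add]
        simp
      refine lt_of_mul_lt_mul_right (lt_of_eq_of_lt ?_ h1) hMN0.le
      linear_combination -(g (l⁻¹ * w) * ∫ v in (-N)..N, fejerKernel v) * h2
    · have hinv : 0 < l⁻¹ := inv_pos.mpr hl0
      have h1 := hmono (l⁻¹ * w) (l⁻¹ * u)
        (mul_le_mul_of_nonneg_left (by linarith [hu.1]) hinv.le)
      have h2 : -(2 * N * l⁻¹) ≤ l⁻¹ * w - l⁻¹ * u := by nlinarith [hu.2]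
      refine le_trans ?_ h1
      gcongr
      exact hg0 _

/-! ### The prime number theorem. -/

/-- Modulus `1` specialises the results behind Dirichlet's theorem to `-ζ'/ζ`. -/
lemma residueClass_one_modulus_one (n : ℕ) :
    vonMangoldt.residueClass (1 : ZMod 1) n = vonMangoldt n := by
  rw [vonMangoldt.residueClass, Set.indicator_of_mem]
  exact Subsingleton.elim _ _

lemma measurable_chebyshev_psi : Measurable Chebyshev.psi := Chebyshev.psi_mono.measurable

open MeasureTheory Set in
lemma LSeries_vonMangoldt_eq_mul_integral_psi {s : ℂ} (hs : 1 < s.re) :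
    LSeries (fun n => (vonMangoldt n : ℂ)) s =
      s * ∫ t in Ioi (1 : ℝ), (Chebyshev.psi t : ℂ) * (t : ℂ) ^ (-(s + 1)) := by
  rw [LSeries_eq_mul_integral_of_nonneg (fun n => vonMangoldt n) zero_le_one hs ?_
    fun n => vonMangoldt_nonneg]
  · congr 1
    refine setIntegral_congr_fun measurableSet_Ioi fun t _ => ?_
    simp [Chebyshev.psi, ← Finset.Icc_add_one_left_eq_Ioc]
  · refine IsBigO.of_bound (Real.log 4 + 4) (Eventually.of_forall fun n => ?_)
    have h := Chebyshev.psi_le_const_mul_self (Nat.cast_nonneg (α := ℝ) n)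
    rw [Chebyshev.psi, Nat.floor_natCast, ← Finset.Icc_add_one_left_eq_Ioc, zero_add] at h
    rw [Real.norm_of_nonneg (Finset.sum_nonneg fun _ _ => vonMangoldt_nonneg)]
    simpa using h

open MeasureTheory Set in
lemma integral_psi_exp_mul_exp (s : ℂ) :
    ∫ t in Ioi (1 : ℝ), (Chebyshev.psi t : ℂ) * (t : ℂ) ^ (-(s + 1 + 1)) =
      ∫ u in Ioi (0 : ℝ), ((Chebyshev.psi (Real.exp u) * Real.exp (-u) : ℝ) : ℂ) *
        Complex.exp (-s * u) := by
  have himg : Ioi (1 : ℝ) = Real.exp '' Ioi 0 := by rw [Real.image_exp_Ioi, Real.exp_zero]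
  rw [himg, integral_image_eq_integral_abs_deriv_smul measurableSet_Ioi
    (fun u _ => (Real.hasDerivAt_exp u).hasDerivWithinAt) Real.exp_injective.injOn]
  refine setIntegral_congr_fun measurableSet_Ioi fun u _ => ?_
  simp only [abs_of_pos (Real.exp_pos u), Complex.real_smul]
  have h : ((Real.exp u : ℝ) : ℂ) ^ (-(s + 1 + 1)) = Complex.exp (u * (-(s + 1 + 1))) := by
    rw [Complex.cpow_def_of_ne_zero (by exact_mod_cast (Real.exp_pos u).ne'),
      ← Complex.ofReal_log (Real.exp_pos u).le, Real.log_exp]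
  have h2 : (Real.exp u : ℂ) * Complex.exp (u * (-(s + 1 + 1))) =
      Real.exp (-u) * Complex.exp (-s * u) := by
    push_cast
    rw [← Complex.exp_add, ← Complex.exp_add]
    ring_nf
  rw [h]
  push_cast at h2 ⊢
  linear_combination (Chebyshev.psi (Real.exp u) : ℂ) * h2

lemma psi_exp_mul_exp_neg_nonneg (u : ℝ) : 0 ≤ Chebyshev.psi (Real.exp u) * Real.exp (-u) :=
  mul_nonneg (Chebyshev.psi_nonneg _) (Real.exp_nonneg _)

lemma psi_exp_mul_exp_neg_le (u : ℝ) :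
    Chebyshev.psi (Real.exp u) * Real.exp (-u) ≤ Real.log 4 + 4 := by
  have h := mul_le_mul_of_nonneg_right
    (Chebyshev.psi_le_const_mul_self (Real.exp_nonneg u)) (Real.exp_nonneg (-u))
  rwa [mul_assoc, ← Real.exp_add, add_neg_cancel, Real.exp_zero, mul_one] at h

lemma measurable_psi_exp_mul_exp_neg :
    Measurable fun u : ℝ => Chebyshev.psi (Real.exp u) * Real.exp (-u) := by
  have := measurable_chebyshev_psi
  fun_prop

-- With `A` equal to `-ζ'/ζ (s + 1) - 1/s`, the transform is `(A + 1/s)/(s + 1) - 1/s = (A - 1)/(s +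
-- 1)`: the pole at `0` cancels.
open MeasureTheory Set in
lemma laplace_psi_exp_sub_one {s : ℂ} (hs : 0 < s.re) :
    ∫ u in Ioi (0 : ℝ), ((Chebyshev.psi (Real.exp u) * Real.exp (-u) - 1 : ℝ) : ℂ) *
        Complex.exp (-s * u) =
      (vonMangoldt.LFunctionResidueClassAux (1 : ZMod 1) (s + 1) - 1) / (s + 1) := by
  have hexp : IntegrableOn (fun u : ℝ => Complex.exp (-s * u)) (Ioi 0) :=
    integrableOn_exp_mul_complex_Ioi (by simpa using hs) 0
  have h1 : IntegrableOn (fun u : ℝ =>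
      ((Chebyshev.psi (Real.exp u) * Real.exp (-u) : ℝ) : ℂ) * Complex.exp (-s * u)) (Ioi 0) := by
    refine Integrable.bdd_mul (c := Real.log 4 + 4) hexp ?_ (Eventually.of_forall fun u => ?_)
    · have := measurable_psi_exp_mul_exp_neg
      exact Measurable.aestronglyMeasurable (by fun_prop)
    · rw [Complex.norm_real, Real.norm_of_nonneg (psi_exp_mul_exp_neg_nonneg u)]
      exact psi_exp_mul_exp_neg_le u
  have hs0 : s ≠ 0 := by
    rintro rfl
    simp at hs
  have hs1 : s + 1 ≠ 0 := by
    intro h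
    have := congrArg Complex.re h
    simp at this
    linarith
  have hL := LSeries_vonMangoldt_eq_mul_integral_psi (s := s + 1) (by simpa using hs)
  rw [integral_psi_exp_mul_exp] at hL
  have hA := vonMangoldt.eqOn_LFunctionResidueClassAux (q := 1) (a := 1) isUnit_one
    (show s + 1 ∈ {s : ℂ | 1 < s.re} by simpa using hs)
  simp only [residueClass_one_modulus_one, hL] at hA
  have hI : ∫ u in Ioi (0 : ℝ), Complex.exp (-s * u) = 1 / s := by
    rw [integral_exp_mul_complex_Ioi (by simpa using hs)]
    simp
  simp only [Complex.ofReal_sub, sub_mul, Complex.ofReal_one, one_mul]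
  rw [integral_sub h1 hexp, hI, hA]
  simp
  field_simp
  ring_nf

/-- The **prime number theorem** for the Chebyshev function `ψ`, in exponential form. -/
theorem tendsto_psi_exp_mul_exp_neg :
    Tendsto (fun u : ℝ => Chebyshev.psi (Real.exp u) * Real.exp (-u)) atTop (𝓝 1) := by
  refine tendsto_one_of_laplace_sub_one measurable_psi_exp_mul_exp_neg psi_exp_mul_exp_neg_nonneg
    psi_exp_mul_exp_neg_le (fun u v huv => ?_) ?_ fun s hs => laplace_psi_exp_sub_one hs
  · rw [mul_assoc, ← Real.exp_add, show -u + (u - v) = -v by ring]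
    gcongr
  · refine ContinuousOn.div (ContinuousOn.sub ?_ continuousOn_const) (by fun_prop) fun s hs h => ?_
    -- The arithmetic input: this continuity up to `Re s = 1` encodes the nonvanishing of `ζ` there.
    · refine (vonMangoldt.continuousOn_LFunctionResidueClassAux (q := 1) 1).comp
        (by fun_prop) fun s hs => ?_
      simpa using hs
    · have h2 := congrArg Complex.re h
      simp only [Complex.add_re, Complex.one_re, Complex.zero_re] at h2
      have : 0 ≤ s.re := hs
      linarith

theorem tendsto_psi_div_self : Tendsto (fun x : ℝ => Chebyshev.psi x / x) atTop (𝓝 1) := by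
  refine (tendsto_psi_exp_mul_exp_neg.comp Real.tendsto_log_atTop).congr' ?_
  filter_upwards [eventually_gt_atTop 0] with x hx
  simp [Real.exp_neg, Real.exp_log hx, div_eq_mul_inv]

theorem tendsto_theta_div_self : Tendsto (fun x : ℝ => Chebyshev.theta x / x) atTop (𝓝 1) := by
  have h : (Chebyshev.psi - Chebyshev.theta) =o[atTop] (fun x : ℝ => x) := by
    refine Chebyshev.isBigO_psi_sub_theta_sqrt.trans_isLittleO ?_
    refine isLittleO_of_tendsto (by simp +contextual) ?_
    simpa only [Real.sqrt_div_self'] using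
      (tendsto_inv_atTop_zero.comp Real.tendsto_sqrt_atTop).congr fun x => (one_div _).symm
  have h2 := tendsto_psi_div_self.sub h.tendsto_div_nhds_zero
  rw [sub_zero] at h2
  refine h2.congr fun x => ?_
  simp only [Pi.sub_apply]
  ring

/-- The **prime number theorem**. -/
theorem primeCounting_isEquivalent :
    (fun n : ℕ => (Nat.primeCounting n : ℝ)) ~[atTop] (fun n : ℕ => (n : ℝ) / Real.log n) := by
  have h1 : (fun x : ℝ => Chebyshev.theta x / Real.log x) ~[atTop] fun x => x / Real.log x :=
    (isEquivalent_of_tendsto_one tendsto_theta_div_self).div IsEquivalent.refl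
  -- The difference is `O(x / log² x)`.
  have h2 : (fun x : ℝ => (Nat.primeCounting ⌊x⌋₊ : ℝ) - Chebyshev.theta x / Real.log x)
      =o[atTop] fun x : ℝ => x / Real.log x := by
    refine Chebyshev.primeCounting_sub_theta_div_log_isBigO.trans_isLittleO ?_
    refine isLittleO_of_tendsto' ?_ (Real.tendsto_log_atTop.inv_tendsto_atTop.congr' ?_)
    · filter_upwards [eventually_gt_atTop 1] with x hx h
      have := Real.log_pos hx
      have : 0 < x / Real.log x := by positivity
      exact absurd h this.ne'
    · filter_upwards [eventually_gt_atTop 1] with x hx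
      have := Real.log_pos hx
      simp only [Pi.inv_apply]
      field_simp
  have h3 := (h2.add_isEquivalent h1).congr_left
    (Eventually.of_forall fun x => by simp : _ =ᶠ[atTop] fun x : ℝ => (Nat.primeCounting ⌊x⌋₊ : ℝ))
  simpa [Function.comp_def] using! h3.comp_tendsto tendsto_natCast_atTop_atTop

/-! ### Exact values at factorials. -/

lemma primeFactors_factorial_eq (n : ℕ) : (n !).primeFactors = {p ∈ Finset.Icc 1 n | p.Prime} := by
  ext p
  simp only [Nat.mem_primeFactors, Finset.mem_filter, Finset.mem_Icc]
  constructor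
  · rintro ⟨hp, hdvd, -⟩
    exact ⟨⟨hp.one_le, hp.dvd_factorial.mp hdvd⟩, hp⟩
  · rintro ⟨⟨-, hle⟩, hp⟩
    exact ⟨hp, hp.dvd_factorial.mpr hle, n.factorial_ne_zero⟩

lemma card_filter_prime_Icc_one (n : ℕ) :
    ({p ∈ Finset.Icc 1 n | p.Prime} : Finset ℕ).card = n.primeCounting := by
  rw [← Nat.primesLE_eq_filter_Icc_one, Nat.primesLE_card_eq_primeCounting]

lemma cardDistinctFactors_factorial (n : ℕ) : cardDistinctFactors (n !) = n.primeCounting := by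
  rw [← card_filter_prime_Icc_one, ← primeFactors_factorial_eq, cardDistinctFactors_apply]
  rfl

lemma cardFactors_factorial (n : ℕ) :
    cardFactors (n !) = ∑ k ∈ Finset.Icc 1 n, cardFactors k := by
  induction n with
  | zero => simp
  | succ n ih =>
    rw [Nat.factorial_succ, cardFactors_mul n.succ_ne_zero n.factorial_ne_zero, ih,
      Finset.sum_Icc_succ_top (by omega), add_comm]

lemma IsCompletelyAdditive.map_factorial {f : ℕ → ℝ} (hf : IsCompletelyAdditive f) (n : ℕ) :
    f (n !) = ∑ k ∈ Finset.Icc 1 n, f k := by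
  induction n with
  | zero =>
    -- `f 1 = f 1 + f 1` forces `f 1 = 0`.
    have := hf 1 1 one_pos one_pos
    simp only [mul_one] at this
    simpa using this
  | succ n ih =>
    rw [Nat.factorial_succ, hf _ _ n.succ_pos n.factorial_pos, ih,
      Finset.sum_Icc_succ_top (by omega), add_comm]

lemma IsStronglyAdditive.eq_sum_primeFactors {g : ℕ → ℝ} (hg : IsStronglyAdditive g) {n : ℕ}
    (hn : n ≠ 0) : g n = ∑ p ∈ n.primeFactors, g p := by
  induction n using Nat.recOnPosPrimePosCoprime with
  | prime_pow p k hp hk => rw [hg.2 p k hp hk, Nat.primeFactors_prime_pow hk.ne' hp]; simp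
  | zero => exact absurd rfl hn
  | one =>
    have := hg.1 1 1 one_pos one_pos (Nat.coprime_one_left 1)
    simp only [mul_one] at this
    simpa using this
  | coprime a b ha hb hab iha ihb =>
    rw [hg.1 a b (by omega) (by omega) hab, iha (by omega), ihb (by omega),
      hab.primeFactors_mul, Finset.sum_union hab.disjoint_primeFactors]

lemma IsStronglyAdditive.map_factorial {g : ℕ → ℝ} (hg : IsStronglyAdditive g) (n : ℕ) :
    g (n !) = ∑ p ∈ Finset.Icc 1 n with p.Prime, g p := by
  rw [hg.eq_sum_primeFactors n.factorial_ne_zero, primeFactors_factorial_eq]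

/-! ### Mertens' second theorem. -/

/-- The sum of the reciprocals of the primes up to `n`. -/
noncomputable def sumPrimeInv (n : ℕ) : ℝ := ∑ p ∈ Finset.Icc 1 n with p.Prime, (p : ℝ)⁻¹

lemma primeCounting_succ_cast (n : ℕ) :
    ((n + 1).primeCounting : ℝ) = n.primeCounting + if (n + 1).Prime then 1 else 0 := by
  simp only [Nat.primeCounting, Nat.primeCounting', Nat.count_succ]
  push_cast
  rfl

/-- Summation by parts for the sum of the reciprocals of the primes. -/
lemma sumPrimeInv_eq (n : ℕ) : sumPrimeInv n = (n.primeCounting : ℝ) / n +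
    ∑ k ∈ Finset.range n, (k.primeCounting : ℝ) / (k * (k + 1)) := by
  induction n with
  | zero => simp [sumPrimeInv]
  | succ n ih =>
    have hS : sumPrimeInv (n + 1) =
        sumPrimeInv n + if (n + 1).Prime then ((n + 1 : ℕ) : ℝ)⁻¹ else 0 := by
      simp only [sumPrimeInv, Finset.sum_filter]
      rw [Finset.sum_Icc_succ_top (by omega)]
    rw [hS, ih, Finset.sum_range_succ, primeCounting_succ_cast]
    -- The terms with denominator `0` vanish by the convention `x / 0 = 0`.
    rcases eq_or_ne n 0 with rfl | hn
    · simp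
    · have : (n : ℝ) ≠ 0 := by exact_mod_cast hn
      push_cast
      split_ifs <;> field_simp <;> ring

/-- `log (log n)`, frozen below `3` so as to be monotone. -/
noncomputable def logLogTrunc (n : ℕ) : ℝ := Real.log (Real.log (max n 3 : ℕ))

lemma logLogTrunc_eventuallyEq :
    logLogTrunc =ᶠ[atTop] fun n : ℕ => Real.log (Real.log n) := by
  filter_upwards [eventually_ge_atTop 3] with n hn
  rw [logLogTrunc, max_eq_left hn]

lemma one_lt_log_of_three_le {n : ℕ} (hn : 3 ≤ n) : 1 < Real.log n := by
  rw [Real.lt_log_iff_exp_lt (by positivity)]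
  have : (3 : ℝ) ≤ n := by exact_mod_cast hn
  linarith [Real.exp_one_lt_d9]

lemma logLogTrunc_mono : Monotone logLogTrunc := by
  intro m n hmn
  unfold logLogTrunc
  have h1 := one_lt_log_of_three_le (le_max_right m 3)
  have h0 : 3 ≤ max m 3 := le_max_right m 3
  have h2 : 0 < ((max m 3 : ℕ) : ℝ) := by
    have : 0 < max m 3 := by omega
    exact_mod_cast this
  exact Real.log_le_log (by linarith) (Real.log_le_log h2
    (by exact_mod_cast max_le_max_right 3 hmn))

lemma tendsto_log_log_natCast : Tendsto (fun n : ℕ => Real.log (Real.log n)) atTop atTop :=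
  Real.tendsto_log_atTop.comp (Real.tendsto_log_atTop.comp tendsto_natCast_atTop_atTop)

lemma tendsto_logLogTrunc : Tendsto logLogTrunc atTop atTop :=
  tendsto_log_log_natCast.congr' logLogTrunc_eventuallyEq.symm

lemma log_natCast_succ_sub_log_bounds {n : ℕ} (hn : 0 < n) :
    ((n : ℝ) + 1)⁻¹ ≤ Real.log (n + 1) - Real.log n ∧
      Real.log (n + 1) - Real.log n ≤ (n : ℝ)⁻¹ := by
  have hn' : (0 : ℝ) < n := by exact_mod_cast hn
  rw [← Real.log_div (by positivity) (by positivity)]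
  constructor
  · refine le_trans (le_of_eq ?_) (Real.one_sub_inv_le_log_of_pos (by positivity))
    field_simp
    ring
  · refine (Real.log_le_sub_one_of_pos (by positivity)).trans (le_of_eq ?_)
    field_simp
    ring

lemma log_natCast_succ_isEquivalent :
    (fun n : ℕ => Real.log ((n : ℝ) + 1)) ~[atTop] fun n : ℕ => Real.log n := by
  have hlog : Tendsto (fun n : ℕ => Real.log n) atTop atTop :=
    Real.tendsto_log_atTop.comp tendsto_natCast_atTop_atTop
  have h : Tendsto (fun n : ℕ => Real.log ((n : ℝ) + 1) - Real.log n) atTop (𝓝 0) :=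
    Real.tendsto_log_nat_add_one_sub_log
  exact h.isBigO_one ℝ |>.trans_isLittleO
    (isLittleO_one_left_iff ℝ |>.mpr (tendsto_norm_atTop_atTop.comp hlog))

lemma natCast_succ_isEquivalent :
    (fun n : ℕ => (n : ℝ) + 1) ~[atTop] fun n : ℕ => (n : ℝ) := by
  refine IsEquivalent.add_isLittleO IsEquivalent.refl ?_
  exact isLittleO_one_left_iff ℝ |>.mpr
    (tendsto_norm_atTop_atTop.comp tendsto_natCast_atTop_atTop)

/-- `1 - 1/x ≤ log x ≤ x - 1`, applied to the ratio of consecutive logarithms and combined with the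
analogous bounds for `log (n + 1) - log n`. -/
lemma logLogTrunc_succ_sub_bounds {n : ℕ} (hn : 3 ≤ n) :
    (((n : ℝ) + 1) * Real.log (n + 1))⁻¹ ≤ logLogTrunc (n + 1) - logLogTrunc n ∧
      logLogTrunc (n + 1) - logLogTrunc n ≤ ((n : ℝ) * Real.log n)⁻¹ := by
  have h1 := one_lt_log_of_three_le hn
  have h2 := one_lt_log_of_three_le (show 3 ≤ n + 1 by omega)
  push_cast at h2
  obtain ⟨hl, hu⟩ := log_natCast_succ_sub_log_bounds (show 0 < n by omega)
  rw [logLogTrunc, logLogTrunc, max_eq_left hn, max_eq_left (by omega), Nat.cast_add_one,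
    ← Real.log_div (by positivity) (by positivity), mul_inv, mul_inv]
  constructor
  · refine le_trans ?_ (Real.one_sub_inv_le_log_of_pos (by positivity))
    calc _ ≤ (Real.log (n + 1) - Real.log n) * (Real.log (n + 1))⁻¹ := by gcongr
      _ = _ := by field_simp
  · refine (Real.log_le_sub_one_of_pos (by positivity)).trans ?_
    calc _ = (Real.log (n + 1) - Real.log n) * (Real.log n)⁻¹ := by field_simp
      _ ≤ _ := by gcongr

lemma logLogTrunc_succ_sub_isEquivalent :
    (fun n : ℕ => logLogTrunc (n + 1) - logLogTrunc n) ~[atTop]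
      fun n : ℕ => ((n : ℝ) * Real.log n)⁻¹ := by
  have hlow : (fun n : ℕ => (((n : ℝ) + 1) * Real.log (n + 1))⁻¹) ~[atTop]
      fun n : ℕ => ((n : ℝ) * Real.log n)⁻¹ :=
    (natCast_succ_isEquivalent.mul log_natCast_succ_isEquivalent).inv
  have hne : ∀ᶠ n : ℕ in atTop, 0 < ((n : ℝ) * Real.log n)⁻¹ := by
    filter_upwards [eventually_ge_atTop 3] with n hn
    have := one_lt_log_of_three_le hn
    positivity
  rw [isEquivalent_iff_tendsto_one (hne.mono fun n h => h.ne')] at hlow ⊢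
  refine tendsto_of_tendsto_of_tendsto_of_le_of_le' hlow tendsto_const_nhds ?_ ?_
  · filter_upwards [eventually_ge_atTop 3, hne] with n hn h0
    exact div_le_div_of_nonneg_right (logLogTrunc_succ_sub_bounds hn).1 h0.le
  · filter_upwards [eventually_ge_atTop 3, hne] with n hn h0
    exact div_le_one_of_le₀ (logLogTrunc_succ_sub_bounds hn).2 h0.le

lemma primeCounting_div_isEquivalent :
    (fun n : ℕ => (n.primeCounting : ℝ) / (n * (n + 1))) ~[atTop]
      fun n : ℕ => logLogTrunc (n + 1) - logLogTrunc n := by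
  refine IsEquivalent.trans ?_ logLogTrunc_succ_sub_isEquivalent.symm
  refine (primeCounting_isEquivalent.div
    (IsEquivalent.refl.mul natCast_succ_isEquivalent)).trans_eventuallyEq ?_
  filter_upwards [eventually_ge_atTop 3] with n hn
  have := one_lt_log_of_three_le hn
  simp only [Pi.div_apply, Pi.mul_apply]
  field_simp

/-- **Mertens' second theorem**, in its weak asymptotic form. -/
theorem sumPrimeInv_isEquivalent :
    sumPrimeInv ~[atTop] fun n : ℕ => Real.log (Real.log n) := by
  have hsum (n : ℕ) : ∑ k ∈ Finset.range n, (logLogTrunc (k + 1) - logLogTrunc k) =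
      logLogTrunc n - logLogTrunc 0 := Finset.sum_range_sub _ n
  -- Equivalence of terms survives summation because the comparison terms are nonnegative with
  -- divergent sum; this is why `logLogTrunc` must be monotone from `0` on.
  have h1 := IsLittleO.sum_range primeCounting_div_isEquivalent.isLittleO
    (fun k => sub_nonneg.mpr (logLogTrunc_mono k.le_succ)) (by
      simp only [hsum]
      exact tendsto_atTop_add_const_right _ _ tendsto_logLogTrunc)
  simp only [hsum, Pi.sub_apply, Finset.sum_sub_distrib] at h1
  have hone : (fun _ : ℕ => (1 : ℝ)) =o[atTop] logLogTrunc :=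
    isLittleO_one_left_iff ℝ |>.mpr (tendsto_norm_atTop_atTop.comp tendsto_logLogTrunc)
  have h2 : (fun n => logLogTrunc n - logLogTrunc 0) ~[atTop] logLogTrunc :=
    IsEquivalent.refl.sub_isLittleO ((isBigO_const_const _ one_ne_zero _).trans_isLittleO hone)
  have h3 : (fun n : ℕ => (n.primeCounting : ℝ) / n) =o[atTop] logLogTrunc := by
    refine IsBigO.trans_isLittleO (IsBigO.of_bound 1 (Eventually.of_forall fun n => ?_)) hone
    rw [Real.norm_of_nonneg (by positivity), norm_one, mul_one]
    refine div_le_one_of_le₀ ?_ (Nat.cast_nonneg n)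
    have := Finset.card_filter_le (Finset.Icc 1 n) Nat.Prime
    rw [card_filter_prime_Icc_one, Nat.card_Icc, Nat.add_sub_cancel] at this
    exact_mod_cast this
  have h4 : (fun n => ∑ k ∈ Finset.range n, (k.primeCounting : ℝ) / (k * (k + 1)))
      ~[atTop] logLogTrunc := by
    refine IsEquivalent.trans ?_ h2
    simpa only [hsum] using! h1
  refine (IsEquivalent.congr_right ?_ logLogTrunc_eventuallyEq)
  refine (h3.add_isEquivalent h4).congr_left (Eventually.of_forall fun n => ?_)
  exact (sumPrimeInv_eq n).symm

/-! ### Legendre's formula and the size of `Ω(n!)`. -/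

lemma div_sub_one_le_factorization_factorial {p n : ℕ} (hp : p.Prime) (hpn : p ≤ n) :
    (n : ℝ) * (p : ℝ)⁻¹ - 1 ≤ (n !).factorization p := by
  have h : n / p ≤ (n !).factorization p := by
    rw [Nat.factorization_factorial hp (Nat.lt_succ_self _)]
    have h1 : 1 ≤ Nat.log p n := (Nat.le_log_iff_pow_le hp.one_lt (by have := hp.pos; omega)).mpr
      (by simpa using hpn)
    simpa using Finset.single_le_sum (f := fun i => n / p ^ i) (fun _ _ => Nat.zero_le _)
      (Finset.mem_Ico.mpr ⟨le_refl 1, Nat.lt_succ_of_le h1⟩)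
  have h2 := Nat.lt_floor_add_one ((n : ℝ) / p)
  rw [Nat.floor_div_eq_div] at h2
  have h3 : ((n / p : ℕ) : ℝ) ≤ (n !).factorization p := by exact_mod_cast h
  rw [← div_eq_mul_inv]
  linarith

/-- Legendre: `(p - 1) v_p(n!)` is `n` minus the base-`p` digit sum of `n`. -/
lemma factorization_factorial_le_div {p n : ℕ} (hp : p.Prime) :
    ((n !).factorization p : ℝ) ≤ n * ((p : ℝ) - 1)⁻¹ := by
  have h : (p - 1) * (n !).factorization p ≤ n := by
    rw [Nat.sub_one_mul_factorization_factorial hp]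
    exact Nat.sub_le _ _
  have h2 : ((p : ℝ) - 1) * (n !).factorization p ≤ n := by
    rw [← Nat.cast_pred hp.pos]
    exact_mod_cast h
  have hp1 : (1 : ℝ) < p := by exact_mod_cast hp.one_lt
  rw [← div_eq_mul_inv, le_div_iff₀ (by linarith)]
  linarith

/-- Enlarging the sum to all integers from `2` to `n` makes it telescope to `1 - 1/n`. -/
lemma sum_prime_inv_sub_one_sub_inv_le (n : ℕ) :
    ∑ p ∈ Finset.Icc 1 n with p.Prime, (((p : ℝ) - 1)⁻¹ - (p : ℝ)⁻¹) ≤ 1 := by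
  suffices h : ∑ p ∈ Finset.Icc 1 n with p.Prime, (((p : ℝ) - 1)⁻¹ - (p : ℝ)⁻¹) ≤
      1 - (n : ℝ)⁻¹ from h.trans (by simp)
  induction n with
  | zero => simp
  | succ n ih =>
    rw [Finset.sum_filter] at ih ⊢
    rw [Finset.sum_Icc_succ_top (by omega)]
    -- Since `0⁻¹ = 0`, the bound drops from `1` to `0` between `n = 0` and `n = 1`, so this step is
    -- separate.
    rcases eq_or_ne n 0 with rfl | hn
    · simp [Nat.not_prime_one]
    · have hn' : (0 : ℝ) < n := by exact_mod_cast Nat.pos_of_ne_zero hn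
      push_cast
      rw [add_sub_cancel_right]
      have : ((n : ℝ) + 1)⁻¹ ≤ (n : ℝ)⁻¹ := inv_anti₀ hn' (by linarith)
      split_ifs <;> linarith

/-- Below, each of at most `n` primes loses at most `1`; above, the excess at `p` is at most `n
(1/(p-1) - 1/p)`, which sums to at most `n`. -/
lemma abs_cardFactors_factorial_sub_le (n : ℕ) :
    |(cardFactors (n !) : ℝ) - n * sumPrimeInv n| ≤ n := by
  have hO : (cardFactors (n !) : ℝ) =
      ∑ p ∈ Finset.Icc 1 n with p.Prime, ((n !).factorization p : ℝ) := by
    rw [cardFactors_eq_sum_factorization, Finsupp.sum, Nat.support_factorization,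
      primeFactors_factorial_eq]
    push_cast
    rfl
  rw [hO, sumPrimeInv, Finset.mul_sum, ← Finset.sum_sub_distrib, abs_le]
  constructor
  · have h : ∑ p ∈ Finset.Icc 1 n with p.Prime, (-1 : ℝ) ≤
        ∑ p ∈ Finset.Icc 1 n with p.Prime, (((n !).factorization p : ℝ) - n * (p : ℝ)⁻¹) := by
      refine Finset.sum_le_sum fun p hp => ?_
      simp only [Finset.mem_filter, Finset.mem_Icc] at hp
      linarith [div_sub_one_le_factorization_factorial hp.2 hp.1.2]
    refine le_trans ?_ h
    have hcard := Finset.card_filter_le (Finset.Icc 1 n) Nat.Prime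
    rw [Nat.card_Icc, Nat.add_sub_cancel] at hcard
    simpa using hcard
  · calc _ ≤ ∑ p ∈ Finset.Icc 1 n with p.Prime, (n : ℝ) * (((p : ℝ) - 1)⁻¹ - (p : ℝ)⁻¹) := by
          refine Finset.sum_le_sum fun p hp => ?_
          linarith [factorization_factorial_le_div (n := n) (Finset.mem_filter.mp hp).2]
      _ ≤ n := by
          rw [← Finset.mul_sum]
          exact mul_le_of_le_one_right (Nat.cast_nonneg n) (sum_prime_inv_sub_one_sub_inv_le n)

theorem cardFactors_factorial_isEquivalent :
    (fun n : ℕ => (cardFactors (n !) : ℝ)) ~[atTop]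
      fun n : ℕ => (n : ℝ) * Real.log (Real.log n) := by
  have h1 : (fun n : ℕ => (n : ℝ) * sumPrimeInv n) ~[atTop]
      fun n : ℕ => (n : ℝ) * Real.log (Real.log n) :=
    IsEquivalent.refl.mul sumPrimeInv_isEquivalent
  have h2 : (fun n : ℕ => (cardFactors (n !) : ℝ) - n * sumPrimeInv n) =o[atTop]
      fun n : ℕ => (n : ℝ) * Real.log (Real.log n) := by
    have h3 : (fun n : ℕ => (n : ℝ) * 1) =o[atTop] fun n : ℕ => (n : ℝ) * Real.log (Real.log n) :=
      (isBigO_refl _ _).mul_isLittleO (isLittleO_one_left_iff ℝ |>.mpr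
        (tendsto_norm_atTop_atTop.comp tendsto_log_log_natCast))
    refine IsBigO.trans_isLittleO (IsBigO.of_bound 1 (Eventually.of_forall fun n => ?_)) h3
    simpa using abs_cardFactors_factorial_sub_le n
  exact (h2.add_isEquivalent h1).congr_left (Eventually.of_forall fun n => by simp)

theorem mainTheorem9 :
    (∀ n : ℕ, cardDistinctFactors (n !) = Nat.primeCounting n) ∧
    (∀ n : ℕ, cardFactors (n !) = ∑ k ∈ Finset.Icc 1 n, cardFactors k) ∧
    ((fun n : ℕ => (cardDistinctFactors (n !) : ℝ)) ~[atTop]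
      (fun n : ℕ => (n : ℝ) / Real.log n)) ∧
    ((fun n : ℕ => (cardFactors (n !) : ℝ)) ~[atTop]
      (fun n : ℕ => (n : ℝ) * Real.log (Real.log n))) ∧
    (∀ f : ℕ → ℝ, IsCompletelyAdditive f →
      ∀ n : ℕ, f (n !) = ∑ k ∈ Finset.Icc 1 n, f k) ∧
    (∀ g : ℕ → ℝ, IsStronglyAdditive g →
      ∀ n : ℕ, g (n !) = ∑ p ∈ Finset.Icc 1 n with p.Prime, g p) := by
  refine ⟨cardDistinctFactors_factorial, cardFactors_factorial, ?_,
    cardFactors_factorial_isEquivalent, fun f hf => hf.map_factorial, fun g hg => hg.map_factorial⟩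
  simpa only [cardDistinctFactors_factorial] using primeCounting_isEquivalent
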